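/- A group $\Gamma$ is called presentable by a product if there exist groups $\Gamma_1,\Gamma_2$ and a homomorphism $\varphi\colon \Gamma_1\times\Gamma_2\to\Gamma$ such that $\varphi(\Gamma_1\times\{1\})$ and $\varphi(\{1\}\times\Gamma_2)$ are both infinite and $\varphi(\Gamma_1\times\Gamma_2)$ has finite index in $\Gamma$. For nonzero integers $m,n$, let $\mathrm{BS}(m,n)=\langle s,t \mid t s^m t^{-1}=s^n\rangle$ be the Baumslag–Solitar group. Theorem. For all $m,n\in\mathbf{Z}\smallsetminus\{0\}$, the group $\mathrm{BS}(m,n)$ is presentable by a product if and only if $|m|=|n|$. -/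

import Mathlib

universe u v w

/-- A presentation of the group `Γ` by a product: a homomorphism `φ : Γ₁ × Γ₂ → Γ` such that
`φ(Γ₁ × {1})` and `φ({1} × Γ₂)` are infinite and `φ(Γ₁ × Γ₂)` has finite index in `Γ`. -/
structure IsProductPresentation {Γ : Type u} [Group Γ] {Γ₁ : Type v} [Group Γ₁]
    {Γ₂ : Type w} [Group Γ₂] (φ : Γ₁ × Γ₂ →* Γ) : Prop where
  infinite_left : (φ '' (Set.univ ×ˢ {1})).Infinite
  infinite_right : (φ '' ({1} ×ˢ Set.univ)).Infinite
  finiteIndex_range : φ.range.FiniteIndex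

/-- The group `Γ` is presentable by a product. (Such a `Γ` is automatically infinite.)
The factors are taken in the universe of `Γ`; by `IsProductPresentation.presentableByProduct`
below this is no restriction. -/
def PresentableByProduct (Γ : Type u) [Group Γ] : Prop :=
  ∃ (Γ₁ Γ₂ : Type u) (_ : Group Γ₁) (_ : Group Γ₂) (φ : Γ₁ × Γ₂ →* Γ), IsProductPresentation φ

/-- Factors in arbitrary universes may be replaced by their images in `Γ`. -/
theorem IsProductPresentation.presentableByProduct {Γ : Type u} [Group Γ] {Γ₁ : Type v} [Group Γ₁]
    {Γ₂ : Type w} [Group Γ₂] {φ : Γ₁ × Γ₂ →* Γ} (h : IsProductPresentation φ) :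
    PresentableByProduct Γ := by
  let f := φ.comp (MonoidHom.inl Γ₁ Γ₂)
  let g := φ.comp (MonoidHom.inr Γ₁ Γ₂)
  have hc : ∀ (a : f.range) (b : g.range),
      Commute (f.range.subtype a) (g.range.subtype b) := by
    rintro ⟨_, a, rfl⟩ ⟨_, b, rfl⟩
    exact (MonoidHom.commute_inl_inr a b).map φ
  refine ⟨f.range, g.range, inferInstance, inferInstance,
    MonoidHom.noncommCoprod f.range.subtype g.range.subtype hc, ?_, ?_, ?_⟩
  · refine h.infinite_left.mono ?_
    rintro _ ⟨⟨a, b⟩, ⟨-, hb⟩, rfl⟩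
    obtain rfl : b = 1 := hb
    exact ⟨(⟨φ (a, 1), a, rfl⟩, 1), ⟨trivial, rfl⟩, by simp⟩
  · refine h.infinite_right.mono ?_
    rintro _ ⟨⟨a, b⟩, ⟨ha, -⟩, rfl⟩
    obtain rfl : a = 1 := ha
    exact ⟨(1, ⟨φ (1, b), b, rfl⟩), ⟨rfl, trivial⟩, by simp⟩
  · have := h.finiteIndex_range
    refine Subgroup.finiteIndex_of_le (H := φ.range) ?_
    rintro _ ⟨⟨a, b⟩, rfl⟩
    refine ⟨(⟨φ (a, 1), a, rfl⟩, ⟨φ (1, b), b, rfl⟩), ?_⟩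
    simp [← map_mul]

/-- The two generators `s`, `t` of a Baumslag–Solitar group. -/
inductive BSGenerator : Type
  | s : BSGenerator
  | t : BSGenerator

/-- The relator of `t s^m t⁻¹ = s^n`. -/
def bsRelator (m n : ℤ) : FreeGroup BSGenerator :=
  (FreeGroup.of BSGenerator.t * FreeGroup.of BSGenerator.s ^ m * (FreeGroup.of BSGenerator.t)⁻¹) *
    (FreeGroup.of BSGenerator.s ^ n)⁻¹

/-- The Baumslag–Solitar group `BS(m, n) = ⟨s, t ∣ t s^m t⁻¹ = s^n⟩`. -/
abbrev BaumslagSolitar (m n : ℤ) : Type :=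
  PresentedGroup {bsRelator m n}

/-! If `|m| = |n|`, conjugation sends `s ^ m` to itself or its inverse, so its centralizer has
finite index; this centralizer and the powers of `s ^ m` present the group.

If `|m| ≠ |n|`, use the affine representation `toAffine` over `ℚ`. In the affine group commuting is
transitive through nontrivial elements, while the product of the two factors contains powers of `s`
(translations) and of `t` (homotheties). Hence one factor has trivial affine image
(`RatAffineGroup.trivial_or_trivial_of_commute`), and the other contains some `a` with linear part a
power of `n / m`, of infinite order.

The kernel of `toAffine` meets the powers of `s` trivially, so its elements are told apart by
vertices of the locally finite Bass–Serre tree. A power `c` of `a` is hyperbolic, and each `b`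
commuting with it can be multiplied by a power of `c` to move the base vertex a bounded distance.
Properness leaves finitely many `b` in the kernel (`finite_of_commute_of_four_point`), so the first
factor has finite image, a contradiction. -/

/-! ### Lists as vertices of a rooted tree -/

section ListTree

variable {α : Type*}

open Classical in
/-- The length of the longest common prefix of two lists. -/
noncomputable def List.commonPrefixLength : List α → List α → ℕ
  | a :: x, b :: y => if a = b then commonPrefixLength x y + 1 else 0
  | _, _ => 0

namespace List

theorem commonPrefixLength_self (x : List α) : commonPrefixLength x x = x.length := by
  induction x with
  | nil => simp [commonPrefixLength]
  | cons a x ih => simp [commonPrefixLength, ih]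

theorem commonPrefixLength_comm (x y : List α) :
    commonPrefixLength x y = commonPrefixLength y x := by
  induction x generalizing y with
  | nil => cases y <;> simp [commonPrefixLength]
  | cons a x ih =>
    cases y with
    | nil => simp [commonPrefixLength]
    | cons b y => by_cases hab : a = b <;> simp [commonPrefixLength, ih, hab, eq_comm (a := b)]

theorem commonPrefixLength_le_left (x y : List α) : commonPrefixLength x y ≤ x.length := by
  induction x generalizing y with
  | nil => cases y <;> simp [commonPrefixLength]
  | cons a x ih =>
    cases y with
    | nil => simp [commonPrefixLength]
    | cons b y =>
      simp only [commonPrefixLength, length_cons]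
      split_ifs <;> simp [ih]

theorem commonPrefixLength_le_right (x y : List α) : commonPrefixLength x y ≤ y.length :=
  commonPrefixLength_comm x y ▸ commonPrefixLength_le_left y x

/-- The ultrametric inequality behind all metric facts below: the common prefix length is the Gromov
product based at the root. -/
theorem min_commonPrefixLength_le (x y z : List α) :
    min (commonPrefixLength x y) (commonPrefixLength y z) ≤ commonPrefixLength x z := by
  induction x generalizing y z with
  | nil => cases y <;> simp [commonPrefixLength]
  | cons a x ih =>
    cases y with
    | nil => simp [commonPrefixLength]
    | cons b y =>
      cases z with
      | nil => simp [commonPrefixLength]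
      | cons c z =>
        have := ih y z
        by_cases hab : a = b <;> by_cases hbc : b = c
        · simp only [commonPrefixLength, hab, hbc, if_true]; omega
        · simp [commonPrefixLength, hbc]
        · subst hbc
          simp [commonPrefixLength, hab]
        · simp [commonPrefixLength, hab]

theorem commonPrefixLength_append_right (x y : List α) :
    commonPrefixLength x (x ++ y) = x.length := by
  induction x with
  | nil => cases y <;> simp [commonPrefixLength]
  | cons a x ih => simp [commonPrefixLength, ih]

theorem eq_of_commonPrefixLength_eq {x y : List α} (hx : commonPrefixLength x y = x.length)
    (hy : commonPrefixLength x y = y.length) : x = y := by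
  induction x generalizing y with
  | nil => exact (length_eq_zero_iff.1 (by simpa using hy.symm.trans hx)).symm
  | cons a x ih =>
    cases y with
    | nil => simp [commonPrefixLength] at hx
    | cons b y =>
      by_cases hab : a = b
      · simp only [commonPrefixLength, hab, if_true, length_cons, Nat.add_right_cancel_iff]
          at hx hy
        rw [hab, ih hx hy]
      · simp [commonPrefixLength, hab] at hx

/-- The distance between two lists in the tree in which the parent of `a :: x` is `x`. -/
noncomputable def treeDist (x y : List α) : ℕ :=
  x.length + y.length - 2 * commonPrefixLength x.reverse y.reverse

theorem treeDist_add (x y : List α) :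
    treeDist x y + 2 * commonPrefixLength x.reverse y.reverse = x.length + y.length := by
  have h₁ := commonPrefixLength_le_left x.reverse y.reverse
  have h₂ := commonPrefixLength_le_right x.reverse y.reverse
  simp only [length_reverse] at h₁ h₂
  unfold treeDist
  omega

theorem treeDist_self (x : List α) : treeDist x x = 0 := by
  have := treeDist_add x x
  rw [commonPrefixLength_self, length_reverse] at this
  omega

theorem treeDist_comm (x y : List α) : treeDist x y = treeDist y x := by
  rw [treeDist, treeDist, commonPrefixLength_comm, Nat.add_comm]

theorem treeDist_nil (x : List α) : treeDist x [] = x.length := by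
  have h₁ := treeDist_add x []
  have h₂ := commonPrefixLength_le_right x.reverse ([] : List α)
  simp only [length_nil, reverse_nil] at h₁ h₂
  omega

theorem treeDist_cons (a : α) (x : List α) : treeDist x (a :: x) = 1 := by
  have := treeDist_add x (a :: x)
  rw [reverse_cons, commonPrefixLength_append_right, length_reverse, length_cons] at this
  omega

theorem eq_of_treeDist_eq_zero {x y : List α} (h : treeDist x y = 0) : x = y := by
  have h₀ := treeDist_add x y
  have h₁ := commonPrefixLength_le_left x.reverse y.reverse
  have h₂ := commonPrefixLength_le_right x.reverse y.reverse
  rw [length_reverse] at h₁ h₂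
  exact reverse_injective (eq_of_commonPrefixLength_eq
    (by rw [length_reverse]; omega) (by rw [length_reverse]; omega))

theorem treeDist_triangle (x y z : List α) : treeDist x z ≤ treeDist x y + treeDist y z := by
  have h₁ := treeDist_add x y
  have h₂ := treeDist_add y z
  have h₃ := treeDist_add x z
  have h₄ := min_commonPrefixLength_le x.reverse y.reverse z.reverse
  have h₅ := commonPrefixLength_le_right x.reverse y.reverse
  have h₆ := commonPrefixLength_le_left y.reverse z.reverse
  rw [length_reverse] at h₅ h₆
  omega

/-- The lengths cancel, leaving an inequality between Gromov products that follows from four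
ultrametric inequalities. -/
theorem treeDist_four_point (x y z w : List α) :
    treeDist x y + treeDist z w ≤
      max (treeDist x z + treeDist y w) (treeDist x w + treeDist y z) := by
  have hxy := treeDist_add x y
  have hzw := treeDist_add z w
  have hxz := treeDist_add x z
  have hyw := treeDist_add y w
  have hxw := treeDist_add x w
  have hyz := treeDist_add y z
  have h₁ := min_commonPrefixLength_le x.reverse z.reverse y.reverse
  have h₂ := min_commonPrefixLength_le x.reverse w.reverse y.reverse
  have h₃ := min_commonPrefixLength_le z.reverse x.reverse w.reverse
  have h₄ := min_commonPrefixLength_le z.reverse y.reverse w.reverse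
  rw [commonPrefixLength_comm z.reverse y.reverse] at h₁ h₄
  rw [commonPrefixLength_comm w.reverse y.reverse] at h₂
  rw [commonPrefixLength_comm z.reverse x.reverse] at h₃
  generalize commonPrefixLength x.reverse y.reverse = xy at *
  generalize commonPrefixLength z.reverse w.reverse = zw at *
  generalize commonPrefixLength x.reverse z.reverse = xz at *
  generalize commonPrefixLength y.reverse w.reverse = yw at *
  generalize commonPrefixLength x.reverse w.reverse = xw at *
  generalize commonPrefixLength y.reverse z.reverse = yz at *
  omega

theorem treeDist_cons_left {a : α} {x y : List α}
    (h : commonPrefixLength (a :: x).reverse y.reverse ≤ x.length) :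
    treeDist (a :: x) y = treeDist x y + 1 := by
  have h₁ := treeDist_add x y
  have h₂ := treeDist_add (a :: x) y
  have h₃ := min_commonPrefixLength_le x.reverse (a :: x).reverse y.reverse
  have h₄ := min_commonPrefixLength_le (a :: x).reverse x.reverse y.reverse
  have h₅ := commonPrefixLength_le_left x.reverse y.reverse
  rw [commonPrefixLength_comm (a :: x).reverse x.reverse] at h₄
  have h₆ := commonPrefixLength_append_right x.reverse [a]
  rw [← reverse_cons] at h₆
  rw [h₆] at h₃ h₄
  rw [length_reverse] at h₃ h₄ h₅
  rw [length_cons] at h₂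
  omega

/-- Of two distinct vertices, one is not an ancestor of the other, and the geodesic from it starts
towards its parent. This permits induction on the distance. -/
theorem exists_cons_of_treeDist_ne_zero {x y : List α} (h : treeDist x y ≠ 0) :
    (∃ a x', x = a :: x' ∧ treeDist x y = treeDist x' y + 1) ∨
      ∃ b y', y = b :: y' ∧ treeDist x y = treeDist x y' + 1 := by
  have h₀ := treeDist_add x y
  by_cases hx : commonPrefixLength x.reverse y.reverse < x.length
  · cases x with
    | nil => simp at hx
    | cons a x' =>
      exact .inl ⟨a, x', rfl, treeDist_cons_left (Nat.lt_succ_iff.1 hx)⟩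
  · cases y with
    | nil => exact absurd (length_eq_zero_iff.2 rfl) (fun h' => by rw [h'] at h₀; omega)
    | cons b y' =>
      refine .inr ⟨b, y', rfl, ?_⟩
      rw [treeDist_comm, treeDist_comm x]
      refine treeDist_cons_left ?_
      rw [commonPrefixLength_comm]
      rw [length_cons] at h₀
      omega

end List

end ListTree

/-! ### The Bass–Serre tree of an HNN extension -/

namespace HNNExtension

open NormalWord List

variable {G : Type*} [Group G] {A B : Subgroup G} (φ : A ≃* B) (d : TransversalPair G A B)

/-- The list of syllables of the normal form of an element; it determines the element up to
left multiplication by the base group. -/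
noncomputable def syllables (g : HNNExtension G A B φ) : List (ℤˣ × G) :=
  (g • (empty : NormalWord d)).toList

theorem syllables_one : syllables φ d 1 = [] := by
  rw [syllables, one_smul, empty_toList]

theorem syllables_of_mul (x : G) (g : HNNExtension G A B φ) :
    syllables φ d (of x * g) = syllables φ d g := by
  rw [syllables, mul_smul, of_smul_eq_smul, group_smul_toList, syllables]

theorem exists_of_mul_eq_of_syllables_eq {g h : HNNExtension G A B φ}
    (hgh : syllables φ d g = syllables φ d h) : ∃ x, g = of x * h := by
  have hg : (g • (empty : NormalWord d)).prod φ = g := by rw [prod_smul, prod_empty, mul_one]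
  have hh : (h • (empty : NormalWord d)).prod φ = h := by rw [prod_smul, prod_empty, mul_one]
  refine ⟨(g • (empty : NormalWord d)).head * (h • (empty : NormalWord d)).head⁻¹, ?_⟩
  unfold syllables at hgh
  rw [ReducedWord.prod] at hg hh
  rw [hgh, ← eq_inv_mul_iff_mul_eq] at hg
  rw [hg, ← mul_assoc, ← eq_inv_mul_iff_mul_eq, mul_inv_rev, inv_inv] at hh
  rwa [map_mul, map_inv]

theorem exists_eq_of_syllables_eq_cons {g : HNNExtension G A B φ} {a : ℤˣ × G}
    {r : List (ℤˣ × G)} (h : syllables φ d g = a :: r) :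
    ∃ x g', g = of x * (t ^ (a.1 : ℤ) * g') ∧ syllables φ d g' = r := by
  have hg : (g • (empty : NormalWord d)).prod φ = g := by rw [prod_smul, prod_empty, mul_one]
  unfold syllables at h
  generalize g • (empty : NormalWord d) = w at h hg
  cases w using consRecOn with
  | ofGroup x => simp at h
  | cons x u w h₁ h₂ =>
    rw [cons_toList] at h
    obtain ⟨rfl, rfl⟩ := List.cons.inj h
    refine ⟨x, w.prod φ, ?_, ?_⟩
    · rw [← hg, NormalWord.prod_cons]
    · rw [syllables, prod_smul_empty]

/-- Either `t ^ u` becomes a new first syllable or it cancels the existing one; in both cases the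
two vertices are adjacent. -/
theorem syllables_t_mul (u : ℤˣ) (g : HNNExtension G A B φ) :
    ∃ a, syllables φ d (t ^ (u : ℤ) * g) = a :: syllables φ d g ∨
      syllables φ d g = a :: syllables φ d (t ^ (u : ℤ) * g) := by
  simp only [syllables, mul_smul, t_pow_smul_eq_unitsSMul]
  generalize g • (empty : NormalWord d) = w
  unfold unitsSMul
  split_ifs with hc
  · cases w using consRecOn with
    | ofGroup x => simp [Cancels] at hc
    | cons x u' w h₁ h₂ => exact ⟨(u', w.head), .inr (by simp [unitsSMulWithCancel])⟩
  · exact ⟨(u, (unitsSMulGroup φ d u w.head).2), .inl (by simp)⟩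

theorem mem_set_of_mem_syllables {g : HNNExtension G A B φ} {a : ℤˣ × G}
    (h : a ∈ syllables φ d g) : a.2 ∈ d.set a.1 :=
  (g • (empty : NormalWord d)).mem_set _ _ h

/-- The distance in the Bass–Serre tree between the vertices given by two elements. -/
noncomputable def bassSerreDist (g h : HNNExtension G A B φ) : ℕ :=
  treeDist (syllables φ d g) (syllables φ d h)

theorem bassSerreDist_of_mul_t_mul (x : G) (u : ℤˣ) (g : HNNExtension G A B φ) :
    bassSerreDist φ d (of x * (t ^ (u : ℤ) * g)) g = 1 := by
  rw [bassSerreDist, syllables_of_mul]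
  obtain ⟨a, h | h⟩ := syllables_t_mul φ d u g
  · rw [h, treeDist_comm, treeDist_cons]
  · rw [h, treeDist_cons]

/-- Right multiplication carries an edge from `of x * (t ^ u * g')` to `g'` to an edge of the same
form, so the bound follows by induction along a geodesic. -/
theorem bassSerreDist_mul_right_le (g h k : HNNExtension G A B φ) :
    bassSerreDist φ d (g * k) (h * k) ≤ bassSerreDist φ d g h := by
  induction hn : bassSerreDist φ d g h generalizing g h with
  | zero =>
    obtain ⟨x, rfl⟩ := exists_of_mul_eq_of_syllables_eq φ d (eq_of_treeDist_eq_zero hn)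
    rw [bassSerreDist, mul_assoc, syllables_of_mul, treeDist_self]
  | succ n ih =>
    obtain ⟨a, r, hr, hd⟩ | ⟨a, r, hr, hd⟩ := exists_cons_of_treeDist_ne_zero
      (x := syllables φ d g) (y := syllables φ d h) (by rw [bassSerreDist] at hn; omega)
    · obtain ⟨x, g', rfl, rfl⟩ := exists_eq_of_syllables_eq_cons φ d hr
      have h₁ := ih g' h (by unfold bassSerreDist at hn ⊢; omega)
      have h₂ := bassSerreDist_of_mul_t_mul φ d x a.1 (g' * k)
      rw [mul_assoc, mul_assoc]
      have h₃ := treeDist_triangle (syllables φ d (of x * (t ^ (a.1 : ℤ) * (g' * k))))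
        (syllables φ d (g' * k)) (syllables φ d (h * k))
      unfold bassSerreDist at h₁ h₂ ⊢
      omega
    · obtain ⟨x, h', rfl, rfl⟩ := exists_eq_of_syllables_eq_cons φ d hr
      have h₁ := ih g h' (by unfold bassSerreDist at hn ⊢; omega)
      have h₂ := bassSerreDist_of_mul_t_mul φ d x a.1 (h' * k)
      rw [mul_assoc (of x), mul_assoc (t ^ _)]
      have h₃ := treeDist_triangle (syllables φ d (g * k)) (syllables φ d (h' * k))
        (syllables φ d (of x * (t ^ (a.1 : ℤ) * (h' * k))))
      unfold bassSerreDist at h₁ h₂ ⊢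
      rw [treeDist_comm] at h₂
      omega

theorem bassSerreDist_mul_right (g h k : HNNExtension G A B φ) :
    bassSerreDist φ d (g * k) (h * k) = bassSerreDist φ d g h := by
  refine le_antisymm (bassSerreDist_mul_right_le φ d g h k) ?_
  simpa using bassSerreDist_mul_right_le φ d (g * k) (h * k) k⁻¹

/-- Finite index makes the transversals finite, so the syllables form words of length at most `C`
over a finite alphabet. -/
theorem finite_syllables_image [A.FiniteIndex] [B.FiniteIndex] (C : ℕ) :
    (syllables φ d '' {g | bassSerreDist φ d g 1 ≤ C}).Finite := by
  have hfin : ∀ u, (d.set u).Finite := by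
    intro u
    have : (toSubgroup A B u).FiniteIndex := by
      rcases Int.units_eq_one_or u with rfl | rfl <;> assumption
    exact (d.compl u).finite_right
  have hS : {a : ℤˣ × G | a.2 ∈ d.set a.1}.Finite := by
    refine (Set.finite_univ.prod (Set.finite_iUnion hfin)).subset ?_
    exact fun a ha => ⟨trivial, Set.mem_iUnion.2 ⟨a.1, ha⟩⟩
  have := hS.to_subtype
  refine ((List.finite_length_le {a : ℤˣ × G | a.2 ∈ d.set a.1} C).image
    (List.map Subtype.val)).subset ?_
  rintro _ ⟨g, hg, rfl⟩
  rw [Set.mem_ofPred_eq, bassSerreDist, syllables_one, treeDist_nil] at hg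
  obtain ⟨l, hl⟩ : syllables φ d g ∈
      Set.range (List.map (Subtype.val : {a : ℤˣ × G | a.2 ∈ d.set a.1} → ℤˣ × G)) := by
    rw [Set.range_list_map_coe]
    exact fun a ha => mem_set_of_mem_syllables φ d ha
  refine ⟨l, ?_, hl⟩
  rwa [Set.mem_ofPred_eq, ← List.length_map (Subtype.val), hl]

end HNNExtension

/-! ### Commuting elements acting on a locally finite tree -/

section ProperTree

/-- A group acting on a locally finite tree, given by the distance function `dist` between the
vertices (`dist` is right invariant and satisfies the four-point condition, and `v` tells
apart the vertices): an element `a` whose image under a homomorphism `χ` has infinite order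
commutes with only finitely many elements of `ker χ`, up to the stabilizer of the base vertex. -/
theorem finite_of_commute_of_four_point {Γ V M : Type*} [Group Γ] [Group M] (v : Γ → V)
    (dist : Γ → Γ → ℕ) (dist_comm : ∀ g h, dist g h = dist h g)
    (dist_mul : ∀ g h k, dist (g * k) (h * k) = dist g h)
    (four_point : ∀ x y z w, dist x y + dist z w ≤
      max (dist x z + dist y w) (dist x w + dist y z))
    (v_mul : ∀ g h k, v (g * k) = v (h * k) → v g = v h)
    (proper : ∀ C, (v '' {g | dist g 1 ≤ C}).Finite)
    (χ : Γ →* M) (hχ : ∀ g h, v g = v h → χ g = χ h) {a : Γ}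
    (ha : Function.Injective fun i : ℤ => χ a ^ i) {S : Set Γ} (hS : ∀ b ∈ S, Commute a b)
    (hS' : ∀ b ∈ S, χ b = 1) (hv : Set.InjOn v S) : S.Finite := by
  -- some power of `a` is seen to be hyperbolic at the base vertex
  obtain ⟨p, hp, hlt⟩ : ∃ p : ℕ, p ≠ 0 ∧ dist (a ^ p) 1 < dist (a ^ (p * 2)) 1 := by
    by_contra! H
    -- If doubling the exponent never increases the displacement, all `a ^ 2 ^ k` stay in one ball,
    -- yet `χ` separates their vertices.
    have hle : ∀ k : ℕ, dist (a ^ 2 ^ k) 1 ≤ dist a 1 := by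
      intro k
      induction k with
      | zero => simp
      | succ k ih => exact (pow_succ 2 k ▸ H (2 ^ k) (by positivity)).trans ih
    have hinj : Function.Injective fun k : ℕ => v (a ^ 2 ^ k) := by
      intro k l hkl
      have h := hχ _ _ hkl
      rw [map_pow, map_pow, ← zpow_natCast, ← zpow_natCast] at h
      exact Nat.pow_right_injective le_rfl (Nat.cast_injective (ha h))
    refine Set.infinite_range_of_injective hinj ((proper (dist a 1)).subset ?_)
    rintro _ ⟨k, rfl⟩
    exact ⟨_, hle k, rfl⟩
  set c := a ^ p with hc
  have hχc : Function.Injective fun i : ℤ => χ c ^ i := by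
    intro i j hij
    have : χ a ^ (p * i : ℤ) = χ a ^ (p * j : ℤ) := by
      rw [zpow_mul, zpow_mul, zpow_natCast, ← map_pow]
      exact hij
    exact mul_left_cancel₀ (Int.natCast_ne_zero.2 hp) (ha this)
  rw [pow_mul, ← hc] at hlt
  have hinv : ∀ g k, dist g k = dist (g * k⁻¹) 1 := by
    intro g k
    rw [← dist_mul g k k⁻¹, mul_inv_cancel]
  have hmin : ∀ b ∈ S, ∃ i : ℤ, dist (b * c ^ i) 1 ≤ dist c 1 := by
    intro b hb
    have hcb : Commute c b := (hS b hb).pow_left p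
    -- Choose the translate of `b` along `c` nearest the base vertex.
    obtain ⟨i, hi⟩ : ∃ i : ℤ, ∀ j : ℤ, dist (b * c ^ i) 1 ≤ dist (b * c ^ j) 1 := by
      let f : ℤ → ℕ := fun i => dist (b * c ^ i) 1
      exact ⟨Function.argmin f, fun j => Function.argmin_le f j⟩
    refine ⟨i, ?_⟩
    by_contra! hgt
    set x := b * c ^ i with hx
    have hcx : Commute c x := hcb.mul_right (Commute.refl c |>.zpow_right i)
    have h₁ : dist x 1 ≤ dist (x * c) 1 := by
      have := hi (i + 1)
      rwa [zpow_add_one, ← mul_assoc] at this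
    have h₂ : dist x 1 ≤ dist x c := by
      have := hi (i - 1)
      rwa [zpow_sub_one, ← mul_assoc, ← hx, ← hinv] at this
    have e₁ : dist (x * c) c = dist x 1 := by
      rw [← dist_mul x 1 c, one_mul]
    have e₂ : dist x (x * c) = dist c 1 := by
      rw [dist_comm, ← hcx.eq, hinv, mul_inv_cancel_right]
    have e₃ : dist 1 c = dist c 1 := dist_comm _ _
    have e₄ : dist x c⁻¹ = dist (x * c) 1 := by
      rw [hinv, inv_inv]
    have e₅ : dist 1 c⁻¹ = dist c 1 := by
      rw [hinv, inv_inv, one_mul]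
    have e₆ : dist c c⁻¹ = dist (c ^ 2) 1 := by
      rw [hinv, inv_inv, sq]
    -- With minimality, `q₁` forces `x` to be equidistant from `1`, `c` and `c⁻¹`; then `q₂` gives
    -- `dist (c ^ 2) 1 ≤ dist c 1`, contradicting `hlt`.
    have q₁ := four_point x c (x * c) 1
    have q₂ := four_point x 1 c c⁻¹
    rw [dist_comm c (x * c)] at q₁
    omega
  choose! i hi using hmin
  have hmaps : Set.MapsTo (fun b => v (b * c ^ i b)) S (v '' {g | dist g 1 ≤ dist c 1}) :=
    fun b hb => ⟨_, hi b hb, rfl⟩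
  refine Set.Finite.of_injOn hmaps ?_ (proper _)
  intro b hb b' hb' h
  -- As `χ` kills `b`, the vertex of `b * c ^ i b` determines the exponent, hence the vertex of `b`.
  have hχ' := hχ _ _ h
  rw [map_mul, map_mul, hS' b hb, hS' b' hb', one_mul, one_mul, map_zpow, map_zpow] at hχ'
  have hii : i b = i b' := hχc hχ'
  refine hv hb hb' (v_mul _ _ (c ^ i b') ?_)
  simpa only [hii] using h

end ProperTree

/-! ### The affine group of the rational line -/

/-- The action of `ℚˣ` on the additive group of `ℚ` by multiplication. -/
noncomputable def ratUnitsAction : ℚˣ →* MulAut (Multiplicative ℚ) :=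
  (MulAutMultiplicative ℚ).symm.toMonoidHom.comp (DistribMulAction.toAddAut ℚˣ ℚ)

/-- The group of affine transformations of the rational line. -/
abbrev RatAffineGroup : Type := Multiplicative ℚ ⋊[ratUnitsAction] ℚˣ

namespace RatAffineGroup

open Multiplicative SemidirectProduct

theorem ratUnitsAction_apply (u : ℚˣ) (x : ℚ) : ratUnitsAction u (ofAdd x) = ofAdd (u * x) := rfl

theorem toAdd_left_mul (g h : RatAffineGroup) :
    (g * h).left.toAdd = g.left.toAdd + g.right * h.left.toAdd := rfl

/-- Commuting is proportionality of the vectors `(1 - right, left)`, which vanish only at the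
identity. -/
theorem commute_iff {g h : RatAffineGroup} : Commute g h ↔
    (1 - (g.right : ℚ)) * h.left.toAdd = (1 - (h.right : ℚ)) * g.left.toAdd := by
  constructor
  · intro H
    have := congrArg (fun x : RatAffineGroup => x.left.toAdd) H.eq
    simp only [toAdd_left_mul] at this
    linear_combination -this
  · intro H
    refine SemidirectProduct.ext ?_ (mul_comm _ _)
    refine toAdd.injective ?_
    rw [toAdd_left_mul, toAdd_left_mul]
    linear_combination -H

theorem eq_one_iff {g : RatAffineGroup} :
    g = 1 ↔ 1 - (g.right : ℚ) = 0 ∧ g.left.toAdd = 0 := by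
  rw [SemidirectProduct.ext_iff, sub_eq_zero, eq_comm (a := (1 : ℚ)), Units.val_eq_one, and_comm]
  rfl

/-- If two commuting sets of affine transformations have products that are a nontrivial
translation and a nontrivial homothety, then one of the two sets is trivial. -/
theorem trivial_or_trivial_of_commute {S T : Set RatAffineGroup}
    (hST : ∀ a ∈ S, ∀ b ∈ T, Commute a b) {x : ℚ} (hx : x ≠ 0) {u : ℚˣ} (hu : u ≠ 1)
    (hxST : ∃ a ∈ S, ∃ b ∈ T, a * b = inl (ofAdd x))
    (huST : ∃ a ∈ S, ∃ b ∈ T, a * b = inr u) :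
    (∀ a ∈ S, a = 1) ∨ ∀ b ∈ T, b = 1 := by
  by_contra! H
  obtain ⟨⟨a₀, ha₀, ha₀1⟩, b₀, hb₀, hb₀1⟩ := H
  -- Every product `a * b` commutes with `a₀`: `b` does by hypothesis, and `a` does because both `a`
  -- and `a₀` commute with `b₀ ≠ 1`.
  have key : ∀ a ∈ S, ∀ b ∈ T,
      (1 - (a₀.right : ℚ)) * (a * b).left.toAdd = (1 - ((a * b).right : ℚ)) * a₀.left.toAdd := by
    intro a ha b hb
    have h₁ := commute_iff.1 (hST a ha b₀ hb₀)
    have h₂ := commute_iff.1 (hST a₀ ha₀ b hb)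
    have h₃ := commute_iff.1 (hST a₀ ha₀ b₀ hb₀)
    have h₄ : (1 - (a₀.right : ℚ)) * a.left.toAdd = (1 - (a.right : ℚ)) * a₀.left.toAdd := by
      by_cases hb₀ : 1 - (b₀.right : ℚ) = 0
      · refine mul_left_cancel₀ (fun h => hb₀1 (eq_one_iff.2 ⟨hb₀, h⟩) : b₀.left.toAdd ≠ 0) ?_
        linear_combination a.left.toAdd * h₃ - a₀.left.toAdd * h₁
      · refine mul_left_cancel₀ hb₀ ?_
        linear_combination (1 - (a.right : ℚ)) * h₃ - (1 - (a₀.right : ℚ)) * h₁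
    rw [toAdd_left_mul, mul_right, Units.val_mul]
    linear_combination h₄ + a.right * h₂
  obtain ⟨a, ha, b, hb, hab⟩ := hxST
  have h₁ := key a ha b hb
  obtain ⟨a, ha, b, hb, hab'⟩ := huST
  have h₂ := key a ha b hb
  rw [hab, left_inl, right_inl, toAdd_ofAdd, Units.val_one, sub_self, zero_mul] at h₁
  rw [hab', left_inr, right_inr, toAdd_one, mul_zero] at h₂
  refine ha₀1 (eq_one_iff.2 ⟨(mul_eq_zero.1 h₁).resolve_right hx,
    (mul_eq_zero.1 h₂.symm).resolve_left ?_⟩)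
  rw [sub_eq_zero]
  exact fun h => hu (Units.ext h.symm)

end RatAffineGroup

/-! ### Baumslag–Solitar groups and their two representations -/

namespace BaumslagSolitar

open Multiplicative SemidirectProduct

variable (m n : ℤ)

/-- The generator `s` of `BS(m, n)`. -/
def s : BaumslagSolitar m n := PresentedGroup.of BSGenerator.s

/-- The stable letter `t` of `BS(m, n)`. -/
def t : BaumslagSolitar m n := PresentedGroup.of BSGenerator.t

theorem t_mul_s_zpow_mul_t_inv : t m n * s m n ^ m * (t m n)⁻¹ = s m n ^ n := by
  have h : PresentedGroup.mk {bsRelator m n} (FreeGroup.of BSGenerator.t *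
      FreeGroup.of BSGenerator.s ^ m * (FreeGroup.of BSGenerator.t)⁻¹ *
      (FreeGroup.of BSGenerator.s ^ n)⁻¹) = 1 :=
    PresentedGroup.one_of_mem (Set.mem_singleton _)
  rwa [map_mul, map_inv, mul_inv_eq_one, map_mul, map_mul, map_inv, map_zpow, map_zpow] at h

variable {m n}

/-- The homomorphism out of `BS(m, n)` given by two elements satisfying its relation. -/
def lift {H : Type*} [Group H] (x y : H) (h : y * x ^ m * y⁻¹ = x ^ n) :
    BaumslagSolitar m n →* H :=
  PresentedGroup.toGroup (f := fun | .s => x | .t => y) (by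
    rintro _ rfl
    simp only [bsRelator, map_mul, map_inv, map_zpow, FreeGroup.lift_apply_of]
    rw [h, mul_inv_cancel])

section lift

variable {H : Type*} [Group H] (x y : H) (h : y * x ^ m * y⁻¹ = x ^ n)

@[simp] theorem lift_s : lift x y h (s m n) = x := PresentedGroup.toGroup.of _

@[simp] theorem lift_t : lift x y h (t m n) = y := PresentedGroup.toGroup.of _

end lift

theorem eq_top_of_s_mem_of_t_mem {K : Subgroup (BaumslagSolitar m n)} (hs : s m n ∈ K)
    (ht : t m n ∈ K) : K = ⊤ :=
  (Subgroup.eq_top_iff' K).2 <| PresentedGroup.generated_by _ K (by rintro (_ | _) <;> assumption)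

theorem hom_ext {H : Type*} [Group H] {f g : BaumslagSolitar m n →* H}
    (hs : f (s m n) = g (s m n)) (ht : f (t m n) = g (t m n)) : f = g :=
  PresentedGroup.ext (by rintro (_ | _) <;> assumption)

section Affine

variable (hm : m ≠ 0) (hn : n ≠ 0)

/-- The factor by which `t` acts in the affine representation of `BS(m, n)`. -/
def ratio : ℚˣ :=
  Units.mk0 (n : ℚ) (Int.cast_ne_zero.2 hn) / Units.mk0 (m : ℚ) (Int.cast_ne_zero.2 hm)

/-- The affine representation of `BS(m, n)`: `s` is the translation by `1`,
`t` is multiplication by `n / m`. -/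
noncomputable def toAffine : BaumslagSolitar m n →* RatAffineGroup :=
  lift (inl (ofAdd 1)) (inr (ratio hm hn)) (by
    rw [← map_zpow inl, ← map_zpow inl, ← map_inv, ← inl_aut, ← ofAdd_zsmul, ← ofAdd_zsmul,
      RatAffineGroup.ratUnitsAction_apply]
    have : (m : ℚ) ≠ 0 := Int.cast_ne_zero.2 hm
    simp [ratio, this])

theorem toAffine_s_zpow (k : ℤ) : toAffine hm hn (s m n ^ k) = inl (ofAdd (k : ℚ)) := by
  rw [map_zpow, toAffine, lift_s, ← map_zpow inl, ← ofAdd_zsmul, zsmul_one]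

theorem toAffine_t : toAffine hm hn (t m n) = inr (ratio hm hn) := lift_t _ _ _

theorem s_zpow_injective (hm : m ≠ 0) (hn : n ≠ 0) :
    Function.Injective fun k : ℤ => s m n ^ k := by
  intro k l hkl
  have := congrArg (toAffine hm hn) hkl
  simp only [toAffine_s_zpow] at this
  exact Int.cast_injective (ofAdd.injective (inl_injective this))

theorem ratio_zpow_injective (h : |m| ≠ |n|) : Function.Injective fun i : ℤ => ratio hm hn ^ i := by
  intro i j hij
  have := congrArg (fun u : ℚˣ => |(u : ℚ)|) hij
  simp only [Units.val_zpow_eq_zpow_val, abs_zpow] at this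
  refine zpow_right_injective₀ (abs_pos.2 (Units.ne_zero _)) ?_ this
  have hm' : (m : ℚ) ≠ 0 := Int.cast_ne_zero.2 hm
  rw [ratio, Units.val_div_eq_div_val, Units.val_mk0, Units.val_mk0, abs_div, Ne,
    div_eq_one_iff_eq (abs_ne_zero.2 hm')]
  exact fun h' => h (by exact_mod_cast h'.symm)

end Affine

section HNN

theorem finiteIndex_range_zpowGroupHom {k : ℤ} (hk : k ≠ 0) :
    (zpowGroupHom k : Multiplicative ℤ →* Multiplicative ℤ).range.FiniteIndex := by
  have : (AddSubgroup.zmultiples k).toSubgroup.FiniteIndex := by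
    rw [Subgroup.finiteIndex_iff, AddSubgroup.index_toSubgroup, Int.index_zmultiples]
    exact Int.natAbs_ne_zero.2 hk
  refine Subgroup.finiteIndex_of_le (H := (AddSubgroup.zmultiples k).toSubgroup) ?_
  rintro _ ⟨i, hi⟩
  refine ⟨ofAdd i, toAdd.injective ?_⟩
  rw [← hi]
  simp [mul_comm]

theorem zpowGroupHom_injective {k : ℤ} (hk : k ≠ 0) :
    Function.Injective (zpowGroupHom k : Multiplicative ℤ →* Multiplicative ℤ) := by
  intro x y hxy
  have := congrArg toAdd hxy
  simpa [hk] using this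

/-- The isomorphism between the associated subgroups of `BS(m, n)` as an HNN extension of `ℤ`. -/
noncomputable def rangeEquiv (hm : m ≠ 0) (hn : n ≠ 0) :
    (zpowGroupHom m : Multiplicative ℤ →* Multiplicative ℤ).range ≃*
      (zpowGroupHom n : Multiplicative ℤ →* Multiplicative ℤ).range :=
  (MonoidHom.ofInjective (zpowGroupHom_injective hm)).symm.trans
    (MonoidHom.ofInjective (zpowGroupHom_injective hn))

theorem rangeEquiv_apply (hm : m ≠ 0) (hn : n ≠ 0) (x : Multiplicative ℤ) :
    rangeEquiv hm hn ⟨zpowGroupHom m x, x, rfl⟩ = ⟨zpowGroupHom n x, x, rfl⟩ := by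
  have : (⟨zpowGroupHom m x, x, rfl⟩ : (zpowGroupHom m : Multiplicative ℤ →* _).range) =
    MonoidHom.ofInjective (zpowGroupHom_injective hm) x := rfl
  rw [this, rangeEquiv, MulEquiv.trans_apply, MulEquiv.symm_apply_apply]
  rfl

/-- `BS(m, n)` maps to the HNN extension of `ℤ` along `m ℤ ≃ n ℤ`. -/
noncomputable def toHNN (hm : m ≠ 0) (hn : n ≠ 0) :
    BaumslagSolitar m n →* HNNExtension (Multiplicative ℤ) _ _ (rangeEquiv hm hn) :=
  lift (HNNExtension.of (ofAdd 1)) HNNExtension.t (by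
    rw [← map_zpow HNNExtension.of, ← map_zpow HNNExtension.of]
    have := HNNExtension.equiv_eq_conj (φ := rangeEquiv hm hn)
      ⟨zpowGroupHom m (ofAdd 1), ofAdd 1, rfl⟩
    rw [rangeEquiv_apply] at this
    exact this.symm)

/-- The inverse of `toHNN`. -/
noncomputable def ofHNN (hm : m ≠ 0) (hn : n ≠ 0) :
    HNNExtension (Multiplicative ℤ) _ _ (rangeEquiv hm hn) →* BaumslagSolitar m n :=
  HNNExtension.lift (zpowersHom _ (s m n)) (t m n) (by
    rintro ⟨_, x, rfl⟩
    rw [rangeEquiv_apply, ← mul_inv_eq_iff_eq_mul]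
    simp only [zpowGroupHom_apply, map_zpow, zpowersHom_apply]
    rw [zpow_comm, ← conj_zpow, t_mul_s_zpow_mul_t_inv, zpow_comm])

/-- A left inverse suffices: it turns equality of vertices into equality up to a power of `s`. -/
theorem ofHNN_toHNN (hm : m ≠ 0) (hn : n ≠ 0) (g : BaumslagSolitar m n) :
    ofHNN hm hn (toHNN hm hn g) = g := by
  refine DFunLike.congr_fun (f := (ofHNN hm hn).comp (toHNN hm hn)) (g := MonoidHom.id _)
    (hom_ext ?_ ?_) g
  · simp [toHNN, ofHNN]
  · simp [toHNN, ofHNN]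

end HNN

/-- If `a` acts on the affine line with a factor of infinite order, then it commutes with
only finitely many elements of the kernel of the affine representation. -/
theorem finite_of_commute (hm : m ≠ 0) (hn : n ≠ 0) {a : BaumslagSolitar m n}
    (ha : Function.Injective fun i : ℤ => (toAffine hm hn a).right ^ i)
    {S : Set (BaumslagSolitar m n)} (hS : ∀ b ∈ S, Commute a b)
    (hS' : ∀ b ∈ S, toAffine hm hn b = 1) : S.Finite := by
  obtain ⟨d⟩ := HNNExtension.NormalWord.TransversalPair.nonempty (Multiplicative ℤ)
    (zpowGroupHom m : Multiplicative ℤ →* Multiplicative ℤ).range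
    (zpowGroupHom n : Multiplicative ℤ →* Multiplicative ℤ).range
  have := finiteIndex_range_zpowGroupHom hm
  have := finiteIndex_range_zpowGroupHom hn
  have hsyl : ∀ g h, HNNExtension.syllables (rangeEquiv hm hn) d (toHNN hm hn g) =
      HNNExtension.syllables (rangeEquiv hm hn) d (toHNN hm hn h) →
      ∃ k : ℤ, g = s m n ^ k * h := by
    intro g h hgh
    obtain ⟨x, hx⟩ := HNNExtension.exists_of_mul_eq_of_syllables_eq (rangeEquiv hm hn) d hgh
    refine ⟨x.toAdd, ?_⟩
    have := congrArg (ofHNN hm hn) hx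
    rw [map_mul, ofHNN_toHNN, ofHNN_toHNN, ofHNN, HNNExtension.lift_of] at this
    exact this
  refine finite_of_commute_of_four_point (fun g => HNNExtension.syllables (rangeEquiv hm hn) d (toHNN hm hn g))
    (fun g h => HNNExtension.bassSerreDist (rangeEquiv hm hn) d (toHNN hm hn g) (toHNN hm hn h))
    (fun g h => List.treeDist_comm _ _) ?_ (fun x y z w => List.treeDist_four_point _ _ _ _)
    ?_ ?_ (rightHom.comp (toAffine hm hn)) ?_ ha hS ?_ ?_
  · intro g h k
    rw [map_mul, map_mul, HNNExtension.bassSerreDist_mul_right]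
  · intro g h k hgh
    refine List.eq_of_treeDist_eq_zero ?_
    change HNNExtension.bassSerreDist (rangeEquiv hm hn) d (toHNN hm hn g) (toHNN hm hn h) = 0
    rw [← HNNExtension.bassSerreDist_mul_right (rangeEquiv hm hn) d _ _ (toHNN hm hn k),
      ← map_mul, ← map_mul,
      HNNExtension.bassSerreDist, hgh, List.treeDist_self]
  · intro C
    refine (HNNExtension.finite_syllables_image (rangeEquiv hm hn) d C).subset ?_
    rintro _ ⟨g, hg, rfl⟩
    exact ⟨toHNN hm hn g, by simpa using hg, rfl⟩
  · intro g h hgh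
    obtain ⟨k, rfl⟩ := hsyl g h hgh
    rw [map_mul, MonoidHom.comp_apply, toAffine_s_zpow, rightHom_inl, one_mul]
  · intro b hb
    rw [MonoidHom.comp_apply, hS' b hb, map_one]
  -- Elements of the kernel at the same vertex differ by a power of `s` in the kernel, that is, by a
  -- trivial translation.
  · intro b hb b' hb' hbb'
    obtain ⟨k, rfl⟩ := hsyl b b' hbb'
    have h := hS' _ hb
    rw [map_mul, hS' b' hb', mul_one, toAffine_s_zpow, ← map_one inl] at h
    have h := ofAdd.injective (inl_injective h)
    rw [Int.cast_eq_zero] at h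
    rw [h, zpow_zero, one_mul]

/-! ### The two directions of the theorem -/

/-- The Baumslag–Solitar groups with `|m| ≠ |n|` are not presentable by products. -/
theorem not_presentableByProduct (hm : m ≠ 0) (hn : n ≠ 0) (hmn : |m| ≠ |n|) :
    ¬ PresentableByProduct (BaumslagSolitar m n) := by
  rintro ⟨Γ₁, Γ₂, _, _, φ, hφ⟩
  have hcomm : ∀ x y, Commute (φ (x, 1)) (φ (1, y)) := fun x y =>
    (MonoidHom.commute_inl_inr x y).map φ
  have hmul : ∀ x y, φ (x, 1) * φ (1, y) = φ (x, y) := fun x y => by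
    rw [← map_mul, Prod.mk_mul_mk, mul_one, one_mul]
  have hpow : ∀ g : BaumslagSolitar m n, ∃ k : ℕ, k ≠ 0 ∧ ∃ x y, φ (x, 1) * φ (1, y) = g ^ k := by
    intro g
    obtain ⟨k, hk, -, ⟨x, y⟩, hxy⟩ :=
      Subgroup.exists_pow_mem_of_index_ne_zero hφ.finiteIndex_range.index_ne_zero g
    exact ⟨k, hk.ne', x, y, (hmul x y).trans hxy⟩
  obtain ⟨k, hk, x₁, y₁, h₁⟩ := hpow (s m n)
  obtain ⟨l, hl, x₂, y₂, h₂⟩ := hpow (t m n)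
  have hρt : toAffine hm hn (φ (x₂, 1)) * toAffine hm hn (φ (1, y₂)) =
      inr (ratio hm hn ^ l) := by
    rw [← map_mul, h₂, map_pow, toAffine_t, map_pow]
  have hinj : Function.Injective fun i : ℤ => (ratio hm hn ^ l) ^ i := by
    intro i j hij
    have : ratio hm hn ^ (l * i : ℤ) = ratio hm hn ^ (l * j : ℤ) := by
      rw [zpow_mul, zpow_mul, zpow_natCast]
      exact hij
    exact mul_left_cancel₀ (Int.natCast_ne_zero.2 hl) (ratio_zpow_injective hm hn hmn this)
  have hdich := RatAffineGroup.trivial_or_trivial_of_commute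
    (S := Set.range fun x => toAffine hm hn (φ (x, 1)))
    (T := Set.range fun y => toAffine hm hn (φ (1, y)))
    (by rintro _ ⟨x, rfl⟩ _ ⟨y, rfl⟩; exact (hcomm x y).map _)
    (x := k) (Nat.cast_ne_zero.2 hk) (u := ratio hm hn ^ l)
    (fun h => absurd (@hinj 1 0 (by simp [h])) one_ne_zero)
    ⟨_, ⟨x₁, rfl⟩, _, ⟨y₁, rfl⟩, by
      rw [← map_mul, h₁, ← zpow_natCast, toAffine_s_zpow, Int.cast_natCast]⟩
    ⟨_, ⟨x₂, rfl⟩, _, ⟨y₂, rfl⟩, hρt⟩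
  rcases hdich with h | h
  · refine hφ.infinite_left (finite_of_commute hm hn (a := φ (1, y₂)) ?_ ?_ ?_)
    · rw [h (toAffine hm hn (φ (x₂, 1))) ⟨x₂, rfl⟩, one_mul] at hρt
      rwa [hρt, right_inr]
    · rintro _ ⟨⟨x, y⟩, ⟨-, rfl⟩, rfl⟩
      exact (hcomm x y₂).symm
    · rintro _ ⟨⟨x, y⟩, ⟨-, rfl⟩, rfl⟩
      exact h _ ⟨x, rfl⟩
  · refine hφ.infinite_right (finite_of_commute hm hn (a := φ (x₂, 1)) ?_ ?_ ?_)
    · rw [h (toAffine hm hn (φ (1, y₂))) ⟨y₂, rfl⟩, mul_one] at hρt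
      rwa [hρt, right_inr]
    · rintro _ ⟨⟨x, y⟩, ⟨rfl, -⟩, rfl⟩
      exact hcomm x₂ y
    · rintro _ ⟨⟨x, y⟩, ⟨rfl, -⟩, rfl⟩
      exact h _ ⟨y, rfl⟩

/-- If `|m| = |n|`, the centralizer of `s ^ m` has finite index in `BS(m, n)`. -/
theorem finiteIndex_centralizer (hmn : |m| = |n|) :
    (Subgroup.centralizer {s m n ^ m}).FiniteIndex := by
  obtain ⟨e, he⟩ : ∃ e : ℤˣ, n = m * e := by
    rcases abs_eq_abs.1 hmn with h | h
    · exact ⟨1, by simp [h]⟩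
    · exact ⟨-1, by simp [h]⟩
  -- The sign by which conjugation acts on `s ^ m`; its kernel has finite index and centralizes `s ^
  -- m`.
  let w : BaumslagSolitar m n →* ℤˣ := lift 1 e (by simp)
  have hmem : ∀ g, g * s m n ^ m * g⁻¹ = (s m n ^ m) ^ (w g : ℤ) := by
    let K : Subgroup (BaumslagSolitar m n) :=
      { carrier := {g | g * s m n ^ m * g⁻¹ = (s m n ^ m) ^ (w g : ℤ)}
        one_mem' := by simp
        mul_mem' := by
          intro g h hg hh
          simp only [Set.mem_ofPred_eq] at hg hh ⊢
          rw [map_mul, Units.val_mul, zpow_mul, ← hg, conj_zpow, ← hh]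
          group
        inv_mem' := by
          intro g hg
          simp only [Set.mem_ofPred_eq] at hg ⊢
          have h : g * (s m n ^ m) ^ (w g : ℤ) * g⁻¹ = s m n ^ m := by
            rw [← conj_zpow, hg, ← zpow_mul, Int.units_coe_mul_self, zpow_one]
          rw [map_inv, Int.units_inv_eq_self, inv_inv, mul_assoc, inv_mul_eq_iff_eq_mul,
            ← mul_inv_eq_iff_eq_mul.1 h] }
    have hK : K = ⊤ := by
      refine eq_top_of_s_mem_of_t_mem ?_ ?_
      · change s m n * s m n ^ m * (s m n)⁻¹ = _
        simp only [w, lift_s, Units.val_one, zpow_one]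
        group
      · change t m n * s m n ^ m * (t m n)⁻¹ = _
        rw [t_mul_s_zpow_mul_t_inv, ← zpow_mul]
        simp only [w, lift_t, ← he]
    intro g
    exact (hK ▸ Subgroup.mem_top g : g ∈ K)
  refine Subgroup.finiteIndex_of_le (H := w.ker) ?_
  intro g hg
  rw [Subgroup.mem_centralizer_singleton_iff]
  have := hmem g
  rw [MonoidHom.mem_ker.1 hg, Units.val_one, zpow_one, mul_inv_eq_iff_eq_mul] at this
  exact this

/-- The Baumslag–Solitar groups with `|m| = |n|` are presentable by products. -/
theorem presentableByProduct (hm : m ≠ 0) (hn : n ≠ 0) (hmn : |m| = |n|) :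
    PresentableByProduct (BaumslagSolitar m n) := by
  have hcomm : ∀ (a : Subgroup.zpowers (s m n ^ m)) (b : Subgroup.centralizer {s m n ^ m}),
      Commute ((Subgroup.zpowers (s m n ^ m)).subtype a)
        ((Subgroup.centralizer {s m n ^ m}).subtype b) := by
    rintro ⟨_, k, rfl⟩ ⟨b, hb⟩
    exact Commute.zpow_left (Subgroup.mem_centralizer_singleton_iff.1 hb).symm k
  refine IsProductPresentation.presentableByProduct
    (φ := MonoidHom.noncommCoprod (Subgroup.zpowers (s m n ^ m)).subtype
      (Subgroup.centralizer {s m n ^ m}).subtype hcomm) ⟨?_, ?_, ?_⟩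
  · refine (Set.infinite_range_of_injective
      ((s_zpow_injective hm hn).comp (mul_right_injective₀ hm))).mono ?_
    rintro _ ⟨k, rfl⟩
    exact ⟨(⟨_, k, rfl⟩, 1), ⟨trivial, rfl⟩, by simp [zpow_mul]⟩
  · refine (Set.infinite_range_of_injective (s_zpow_injective hm hn)).mono ?_
    rintro _ ⟨k, rfl⟩
    refine ⟨(1, ⟨s m n ^ k, ?_⟩), ⟨rfl, trivial⟩, by simp⟩
    exact Subgroup.mem_centralizer_singleton_iff.2 (zpow_mul_comm _ _ _)
  · have := finiteIndex_centralizer hmn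
    refine Subgroup.finiteIndex_of_le (H := Subgroup.centralizer {s m n ^ m}) ?_
    exact fun g hg => ⟨(1, ⟨g, hg⟩), by simp⟩

end BaumslagSolitar

theorem mainTheorem7 (m n : ℤ) (hm : m ≠ 0) (hn : n ≠ 0) :
    PresentableByProduct (BaumslagSolitar m n) ↔ |m| = |n| :=
  ⟨fun h => by_contra fun hmn => BaumslagSolitar.not_presentableByProduct hm hn hmn h,
    BaumslagSolitar.presentableByProduct hm hn⟩
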